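/- Let $\Bbbk$ be a field and $0\neq v\in\Bbbk$. For an integer $k\ge 0$ let $[k]=\sum_{t=0}^{k-1}v^{-(k-1)+2t}$, let $[-k]=-[k]$, and let $[k]!=[1][2]\cdots[k]$. Let $n\ge 0$ be such that $[n]!\neq 0$ in $\Bbbk$. Let $V$ have basis $y_1,y_{-1}$, and give each $V^{\otimes l}$ the symmetric bilinear form $\langle\cdot,\cdot\rangle$ for which the vectors $y_{i_1}\otimes\cdots\otimes y_{i_l}$ ($i_a=\pm1$) are orthonormal; such a vector has weight $i_1+\cdots+i_l$. Let $F$ act on $V$ by $Fy_1=y_{-1}$, $Fy_{-1}=0$, on $V^{\otimes 0}=\Bbbk$ by $0$, and on $V^{\otimes l}$ through the coproduct $\Delta(F)=F\otimes K^{-1}+1\otimes F$, where $K^{-1}$ multiplies a vector of weight $i$ by $v^{-i}$. Put $\Phi_1(b)=b\otimes y_1$; for $b$ of weight $i$ put $\Phi_2(b)=[i]\,b\otimes y_{-1}-v^{i}\,Fb\otimes y_1$; and put $\Psi(b)=y_1\otimes b\otimes y_{-1}-v\,y_{-1}\otimes b\otimes y_1$. A $1$-factor of length $l$ is a sequence $\alpha=(\alpha_1,\dots,\alpha_l)$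 of signs $\pm1$ with $\alpha_1+\cdots+\alpha_k\ge 0$ for all $k$. If $\alpha_i=1$ and $j$ is the smallest index with $j>i$ and $\alpha_i+\cdots+\alpha_j=0$, then $(i,j)$ is called a pairing of $\alpha$; an index in no pairing is a defect. Set $\omega(\alpha)=\Upsilon_l\cdots\Upsilon_1(1)\in V^{\otimes l}$, where $\Upsilon_i=\Phi_1$ if $\alpha_i=1$ and $\Upsilon_i=\Phi_2$ if $\alpha_i=-1$. Let $N(\alpha)\in V^{\otimes l}$ be the vector obtained from the diagram that links the two indices of each pairing, by taking a tensor factor $y_1$ for each defect and applying $\Psi$ to the vector nested inside each link: $N(\emptyset)=1$, $N(\alpha',1)=N(\alpha')\otimes y_1$, and $N(\alpha',1,\alpha'',-1)=N(\alpha')\otimes\Psi(N(\alpha''))$ whenever the displayed $1$ and $-1$ are paired. A $1$-factor $\beta$ of length $l$ is $\alpha$-compatible if $\beta_i=-\beta_j$ for every pairing $(i,j)$ of $\alpha$. Let $\alpha,\beta$ be $1$-factors of the same length $l\le n$, each with $m$ pairings. Let $i_1,\dots,i_m$ be the positions of the entries $-1$ of $\beta$, let $s_j=\beta_1+\cdots+\beta_{i_j-1}$,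 and let $s'_j=-s_j$ if $\alpha_{i_j}=1$ and $s'_j=s_j+1$ if $\alpha_{i_j}=-1$. Then $$\langle N(\alpha),\omega(\beta)\rangle=\begin{cases} v^m\prod_{j=1}^m[s'_j] & \text{if }\beta\text{ is }\alpha\text{-compatible},\\ 0&\text{otherwise.}\end{cases}$$ -/

import Mathlib

namespace TLTensor

/-! ### Quantum integers -/

section QuantumIntegers

variable {K : Type*} [Field K]

/-- The balanced quantum integer `[n] = ∑_{t=0}^{n-1} v^{-(n-1)+2t}` for `n ≥ 0`. -/
def qNat (v : K) (n : ℕ) : K :=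
  ∑ t ∈ Finset.range n, v ^ (-((n : ℤ) - 1) + 2 * (t : ℤ))

/-- The balanced quantum integer `[a]` for `a ∈ ℤ`, with `[-n] = -[n]`. -/
def qInt (v : K) : ℤ → K
  | Int.ofNat n => qNat v n
  | Int.negSucc n => -qNat v (n + 1)

/-- The quantum factorial `[n]! = [1][2]⋯[n]`. -/
def qFactorial (v : K) (n : ℕ) : K :=
  ∏ i ∈ Finset.range n, qInt v ((i : ℤ) + 1)

end QuantumIntegers

/-! ### Tensor space

`V` is the two-dimensional space with basis `y₁, y₋₁`, indexed by the two signs. All tensor powers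
`V^{⊗ l}` are handled at once as the homogeneous components of the tensor algebra `T(V)`, whose
product is the tensor product of tensors. -/

section TensorSpace

/-- The space `V = V(1)`, with basis `y₁, y₋₁`. -/
abbrev V (K : Type*) [Field K] : Type _ := ℤˣ → K

/-- The tensor algebra of `V`, the direct sum of all the tensor powers `V^{⊗ l}`. -/
abbrev T (K : Type*) [Field K] : Type _ := TensorAlgebra K (V K)

variable (K : Type*) [Field K]

/-- The basis vector `y_i` of `V`, as a tensor of degree one. -/
noncomputable def y (i : ℤˣ) : T K := TensorAlgebra.ι K (Pi.basisFun K ℤˣ i)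

/-- The basis of `T(V)` consisting of all `y_{i₁,…,i_l} = y_{i₁} ⊗ ⋯ ⊗ y_{i_l}`, `l ≥ 0`. -/
noncomputable def wordBasis : Module.Basis (FreeMonoid ℤˣ) K (T K) :=
  (Pi.basisFun K ℤˣ).tensorAlgebra

/-- The basis vector of a word is the tensor product of the vectors of its letters. -/
theorem wordBasis_apply (w : FreeMonoid ℤˣ) :
    wordBasis K w = ((FreeMonoid.toList w).map (y K)).prod := by
  have h : wordBasis K w
      = (TensorAlgebra.equivFreeAlgebra (Pi.basisFun K ℤˣ)).symm
          (FreeAlgebra.equivMonoidAlgebraFreeMonoid.symm (MonoidAlgebra.single w 1)) := by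
    simp [wordBasis, Module.Basis.tensorAlgebra, FreeAlgebra.basisFreeMonoid]
  have h2 : (FreeAlgebra.equivMonoidAlgebraFreeMonoid (R := K) (X := ℤˣ)).symm
      (MonoidAlgebra.single w 1) = ((FreeMonoid.toList w).map (FreeAlgebra.ι K)).prod := by
    change MonoidAlgebra.lift _ _ _ (FreeMonoid.lift (FreeAlgebra.ι K)) _ = _
    rw [MonoidAlgebra.lift_single, one_smul, FreeMonoid.lift_apply]
  rw [h, h2, map_list_prod, List.map_map]
  congr 2
  funext i
  exact TensorAlgebra.equivFreeAlgebra_symm_ι _ i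

open Classical in
/-- The standard symmetric bilinear form: `⟨y_{i₁,…,i_l}, y_{j₁,…,j_l}⟩ = ∏_a ⟨y_{i_a}, y_{j_a}⟩`
with `⟨y_i, y_j⟩ = δ_{ij}`; that is, the vectors `y_{i₁,…,i_l}` are orthonormal (distinct tensor
powers are taken to be orthogonal to each other). -/
noncomputable def form : T K →ₗ[K] T K →ₗ[K] K := (wordBasis K).toDual

variable {K}

/-- The weight of `y_{i₁,…,i_l}` is `i₁ + ⋯ + i_l`. -/
def wordWeight (w : List ℤˣ) : ℤ := (w.map (fun i : ℤˣ => (i : ℤ))).sum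

/-- The action of `K⁻¹`: a vector of weight `i` is multiplied by `v^{-i}`. -/
noncomputable def Kinv (v : K) : T K →ₗ[K] T K :=
  (wordBasis K).constr K
    (fun w => v ^ (-wordWeight (FreeMonoid.toList w)) • wordBasis K w)

/-- The action of `F` on `V`, followed by the inclusion of `V` in `T(V)`:
`F y₁ = y₋₁` and `F y₋₁ = 0`. -/
noncomputable def lowerLetter (i : ℤˣ) : T K := if i = 1 then y K (-1) else 0

/-- The action of `F` on `y_{i₁} ⊗ ⋯ ⊗ y_{i_l}`, by iterating the coproduct
`Δ(F) = F ⊗ K⁻¹ + 1 ⊗ F`, starting from `F = 0` on the trivial module `V^{⊗ 0}`. -/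
noncomputable def lowerWord (v : K) : List ℤˣ → T K
  | [] => 0
  | i :: w => lowerLetter i * Kinv v (w.map (y K)).prod + y K i * lowerWord v w

/-- The action of `F` on tensor space. -/
noncomputable def F (v : K) : T K →ₗ[K] T K :=
  (wordBasis K).constr K (fun w => lowerWord v (FreeMonoid.toList w))

/-- `Φ₁(b) = b ⊗ y₁`. -/
noncomputable def Phi1 (b : T K) : T K := b * y K 1

/-- `Φ₂(b) = [i] b ⊗ y₋₁ - v^i F b ⊗ y₁`, for a vector `b` of weight `i`. -/
noncomputable def Phi2 (v : K) (i : ℤ) (b : T K) : T K :=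
  qInt v i • (b * y K (-1)) - v ^ i • (F v b * y K 1)

/-- Nesting: `Ψ(b) = y₁ ⊗ b ⊗ y₋₁ - v y₋₁ ⊗ b ⊗ y₁`. -/
noncomputable def Psi (v : K) (b : T K) : T K :=
  y K 1 * b * y K (-1) - v • (y K (-1) * b * y K 1)

end TensorSpace

/-! ### 1-factors -/

section OneFactors

variable {l : ℕ}

/-- The sum of the first `k` entries of a sequence of signs. -/
def partialSum (α : Fin l → ℤˣ) (k : ℕ) : ℤ :=
  ∑ i : Fin l with i.val < k, (α i : ℤ)

/-- A sequence of signs is a 1-factor if all its partial sums are nonnegative. -/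
def IsOneFactor (α : Fin l → ℤˣ) : Prop := ∀ k ≤ l, 0 ≤ partialSum α k

/-- `(i, j)` is a pair of paired indices of `α`: `α_i = 1`, and `j` is the smallest index with
`i < j` and `α_i + ⋯ + α_j = 0`. -/
def Paired (α : Fin l → ℤˣ) (i j : Fin l) : Prop :=
  α i = 1 ∧ IsLeast {j : Fin l | i < j ∧ ∑ k ∈ Finset.Icc i j, (α k : ℤ) = 0} j

/-- The number of pairings of `α`. -/
noncomputable def numPairings (α : Fin l → ℤˣ) : ℕ :=
  Set.ncard {p : Fin l × Fin l | Paired α p.1 p.2}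

/-- `β` is `α`-compatible if for every pairing in `α`, the corresponding entries of `β` have
opposite signs. -/
def Compatible (α β : Fin l → ℤˣ) : Prop :=
  ∀ i j : Fin l, Paired α i j → β i = -β j

/-- For a position `j` with `β_j = -1`: with `s = β_1 + ⋯ + β_{j-1}`, the integer `s'` is `-s` if
`α_j = 1`, and `s + 1` if `α_j = -1`. -/
def sPrime (α β : Fin l → ℤˣ) (j : Fin l) : ℤ :=
  if α j = 1 then -partialSum β j else partialSum β j + 1

end OneFactors

/-! ### The two families of maximal vectors -/

section MaximalVectors

variable {K : Type*} [Field K]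

/-- `ω(β) = Υ_l ⋯ Υ_1 (1)` where `Υ_i = Φ₁` if `β_i = 1` and `Υ_i = Φ₂` if `β_i = -1`. The vector
`Υ_{i-1} ⋯ Υ_1 (1)` to which `Υ_i` is applied has weight `β_1 + ⋯ + β_{i-1}`. -/
noncomputable def omegaVec (v : K) : {l : ℕ} → (Fin l → ℤˣ) → T K
  | 0, _ => 1
  | l + 1, β =>
    if β (Fin.last l) = 1 then Phi1 (omegaVec v (Fin.init β))
    else Phi2 v (∑ i, (Fin.init β i : ℤ)) (omegaVec v (Fin.init β))

open Classical in
/-- `N(α)` for a 1-factor `α`, read off its link diagram from the right. If the last entry is `1`,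
the last vertex is a defect and `N(α' || (1)) = N(α') ⊗ y₁`. If it is `-1`, the last vertex is
linked to the vertex paired with it, and `N(α' || (1) || α'' || (-1)) = N(α') ⊗ Ψ(N(α''))`.
(The value `0` occurs only for sequences that are not 1-factors.) -/
noncomputable def natVec (v : K) : {l : ℕ} → (Fin l → ℤˣ) → T K
  | 0, _ => 1
  | l + 1, α =>
    if α (Fin.last l) = 1 then natVec v (Fin.init α) * y K 1
    else if h : ∃ i : Fin (l + 1), Paired α i (Fin.last l) then
      natVec v (fun k : Fin (h.choose : ℕ) => α ⟨k, by omega⟩) *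
        Psi v (natVec v (fun k : Fin (l - ((h.choose : ℕ) + 1)) =>
          α ⟨(h.choose : ℕ) + 1 + k, by omega⟩))
    else 0
termination_by l => l
decreasing_by all_goals omega

end MaximalVectors

end TLTensor

/-! Right multiplication by a tensor `x` is adjoint to contraction of the last factors with `x`
(`form_mul`), so the pairing is the degree-zero coefficient left after contracting `ω(β)` with the
blocks of `N(α)`, taken from right to left. A block without defects contracts by an operator
commuting with `F` (`contract_Psi_F`, `contract_natVecOn_F`). Hence contracting a prefix of `ω(β)`
with a link and its contents gives a multiple of a shorter prefix: zero if compatibility fails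
there, otherwise the product of the local factors (`contract_Psi_omegaPrefix`). The scalars come
from `v[i+1] = [i] + v^(i+1)`. At a defect, an entry `1` of `β` is simply removed, while an entry
`-1` leaves a vector in the image of `F`, to which `N` is orthogonal (`form_natVecOn_F`). Equal
numbers of pairings mean equal weights, and then a compatible `β` is `1` at every defect of `α`. -/

namespace TLTensor

/-! ### Recursions for quantum integers. -/

section QuantumIntegers

variable {K : Type*} [Field K]

theorem qInt_natCast (v : K) (n : ℕ) : qInt v n = qNat v n := rfl

theorem qInt_neg_natCast (v : K) (n : ℕ) : qInt v (-(n : ℤ)) = -qNat v n := by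
  cases n with
  | zero =>
    change qNat v 0 = -qNat v 0
    simp [qNat]
  | succ n => rfl

theorem qInt_neg (v : K) (i : ℤ) : qInt v (-i) = -qInt v i := by
  obtain ⟨n, rfl | rfl⟩ := i.eq_nat_or_neg
  · rw [qInt_neg_natCast, qInt_natCast]
  · rw [neg_neg, qInt_neg_natCast, qInt_natCast, neg_neg]

theorem mul_qNat_succ {v : K} (hv : v ≠ 0) (n : ℕ) :
    v * qNat v (n + 1) = qNat v n + v ^ ((n : ℤ) + 1) := by
  rw [qNat, qNat, Finset.mul_sum, Finset.sum_range_succ]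
  congr 1
  · refine Finset.sum_congr rfl fun t _ => ?_
    rw [← zpow_one_add₀ hv]
    congr 1
    push_cast
    ring
  · rw [← zpow_one_add₀ hv]
    congr 1
    push_cast
    ring

theorem qNat_succ {v : K} (hv : v ≠ 0) (n : ℕ) :
    qNat v (n + 1) = v * qNat v n + v ^ (-(n : ℤ)) := by
  rw [qNat, qNat, Finset.mul_sum, Finset.sum_range_succ']
  congr 1
  · refine Finset.sum_congr rfl fun t _ => ?_
    rw [← zpow_one_add₀ hv]
    congr 1
    push_cast
    ring
  · congr 1
    push_cast
    ring

/-- Splitting off the top summand handles `i ≥ 0`; splitting off the bottom one handles `i < 0`.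
Besides oddness, this is all that the later computations need about quantum integers. -/
theorem mul_qInt_add_one {v : K} (hv : v ≠ 0) (i : ℤ) :
    v * qInt v (i + 1) = qInt v i + v ^ (i + 1) := by
  cases i with
  | ofNat n => exact mul_qNat_succ hv n
  | negSucc n =>
    have h : Int.negSucc n + 1 = -(n : ℤ) := by omega
    rw [h, qInt_neg_natCast]
    change _ = -qNat v (n + 1) + _
    rw [qNat_succ hv]
    ring

end QuantumIntegers

/-! ### Tensor space: contractions and their commutation with `F`. -/

section TensorSpace

variable {K : Type*} [Field K]

theorem wordBasis_ofList (w : List ℤˣ) :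
    wordBasis K (FreeMonoid.ofList w) = (w.map (y K)).prod := by
  rw [wordBasis_apply]; rfl

theorem wordBasis_one : wordBasis K 1 = 1 := by
  rw [wordBasis_apply]; simp

theorem wordBasis_mul_of (w : FreeMonoid ℤˣ) (i : ℤˣ) :
    wordBasis K (w * FreeMonoid.of i) = wordBasis K w * y K i := by
  simp [wordBasis_apply]

/-- A linear map on tensor space is determined by its values at `1` and at the tensors with a
last factor `y_i`. -/
theorem hom_ext_right {M : Type*} [AddCommMonoid M] [Module K M] {f g : T K →ₗ[K] M}
    (h1 : f 1 = g 1) (h : ∀ b i, f (b * y K i) = g (b * y K i)) : f = g := by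
  refine (wordBasis K).ext fun w => ?_
  obtain ⟨w, rfl⟩ := FreeMonoid.ofList.surjective w
  rcases List.eq_nil_or_concat' w with rfl | ⟨u, i, rfl⟩
  · rw [FreeMonoid.ofList_nil, wordBasis_one, h1]
  · rw [FreeMonoid.ofList_append, FreeMonoid.ofList_singleton, wordBasis_mul_of, h]

open Classical in
theorem form_wordBasis (u w : FreeMonoid ℤˣ) :
    form K (wordBasis K u) (wordBasis K w) = if u = w then 1 else 0 := by
  rw [form, Module.Basis.toDual_apply]

variable (K) in
/-- Contraction of the last tensor factor with `y_i`. -/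
noncomputable def contractLetter (i : ℤˣ) : T K →ₗ[K] T K :=
  (wordBasis K).constr K fun w =>
    if w.toList.getLast? = some i then wordBasis K (FreeMonoid.ofList w.toList.dropLast) else 0

theorem contractLetter_one (i : ℤˣ) : contractLetter K i 1 = 0 := by
  rw [← wordBasis_one, contractLetter, Module.Basis.constr_basis]
  simp

theorem contractLetter_mul_y (i j : ℤˣ) (b : T K) :
    contractLetter K i (b * y K j) = if j = i then b else 0 := by
  have h : contractLetter K i ∘ₗ LinearMap.mulRight K (y K j)
      = if j = i then LinearMap.id else 0 := by
    refine (wordBasis K).ext fun w => ?_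
    rw [LinearMap.comp_apply, LinearMap.mulRight_apply, ← wordBasis_mul_of, contractLetter,
      Module.Basis.constr_basis]
    split_ifs <;> simp_all
  have h' := LinearMap.congr_fun h b
  rw [LinearMap.comp_apply, LinearMap.mulRight_apply] at h'
  rw [h']
  split_ifs <;> rfl

variable (K) in
/-- Contraction of the last tensor factors with a tensor: the right adjoint of right
multiplication. -/
noncomputable def contract : T K →ₐ[K] Module.End K (T K) :=
  TensorAlgebra.lift K ((Pi.basisFun K ℤˣ).constr K (contractLetter K))

theorem contract_y (i : ℤˣ) : contract K (y K i) = contractLetter K i := by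
  rw [contract, y, TensorAlgebra.lift_ι_apply, Module.Basis.constr_basis]

theorem form_mul_y (i : ℤˣ) (a b : T K) :
    form K (a * y K i) b = form K a (contractLetter K i b) := by
  have h : form K ∘ₗ LinearMap.mulRight K (y K i)
      = (form K).compl₂ (contractLetter K i) := by
    refine (wordBasis K).ext fun u => hom_ext_right ?_ fun b j => ?_
    · rw [LinearMap.comp_apply, LinearMap.mulRight_apply, LinearMap.compl₂_apply,
        contractLetter_one, ← wordBasis_mul_of, ← wordBasis_one, form_wordBasis, map_zero, if_neg]
      intro h
      simpa using congrArg FreeMonoid.length h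
    · rw [LinearMap.comp_apply, LinearMap.mulRight_apply, LinearMap.compl₂_apply,
        contractLetter_mul_y]
      have h' : form K (wordBasis K u * y K i) ∘ₗ LinearMap.mulRight K (y K j)
          = if j = i then form K (wordBasis K u) else 0 := by
        refine (wordBasis K).ext fun w => ?_
        rw [LinearMap.comp_apply, LinearMap.mulRight_apply, ← wordBasis_mul_of,
          ← wordBasis_mul_of, form_wordBasis]
        have e : u * FreeMonoid.of i = w * FreeMonoid.of j ↔ u = w ∧ i = j := by
          rw [← FreeMonoid.toList.injective.eq_iff, FreeMonoid.toList_mul, FreeMonoid.toList_mul]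
          simp
        by_cases hji : j = i
        · subst hji
          rw [if_pos rfl, form_wordBasis]
          classical exact if_congr (e.trans (and_iff_left rfl)) rfl rfl
        · simp [e, hji, Ne.symm hji]
      have h'' := LinearMap.congr_fun h' b
      rw [LinearMap.comp_apply, LinearMap.mulRight_apply] at h''
      rw [h'']
      split_ifs <;> simp
  exact LinearMap.congr_fun (LinearMap.congr_fun h a) b

/-- The rightmost factor of `x` is contracted first, which is why `contract` preserves the order of
products instead of reversing it. -/
theorem form_mul (x : T K) (a b : T K) :
    form K (a * x) b = form K a (contract K x b) := by
  induction x using TensorAlgebra.induction generalizing a b with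
  | algebraMap r => rw [AlgHom.commutes, Algebra.algebraMap_eq_smul_one,
      Algebra.algebraMap_eq_smul_one]; simp
  | ι x =>
    rw [← (Pi.basisFun K ℤˣ).sum_repr x]
    simp only [map_sum, map_smul, Finset.mul_sum, mul_smul_comm, LinearMap.sum_apply,
      LinearMap.smul_apply]
    refine Finset.sum_congr rfl fun i _ => ?_
    congr 1
    rw [← y, contract_y, form_mul_y]
  | mul x z hx hz => rw [← mul_assoc, hz, hx, map_mul, Module.End.mul_apply]
  | add x z hx hz => rw [mul_add, map_add, map_add, LinearMap.add_apply, hx, hz,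
      LinearMap.add_apply, map_add]

theorem Kinv_prod (v : K) (w : List ℤˣ) :
    Kinv v (w.map (y K)).prod = v ^ (-wordWeight w) • (w.map (y K)).prod := by
  rw [← wordBasis_ofList, Kinv, Module.Basis.constr_basis]; rfl

theorem F_prod (v : K) (w : List ℤˣ) : F v (w.map (y K)).prod = lowerWord v w := by
  rw [← wordBasis_ofList, F, Module.Basis.constr_basis]; rfl

theorem F_one (v : K) : F v (1 : T K) = 0 := F_prod v []

/-- Coassociativity: `lowerWord` splits off the first letter, but contractions act at the right end,
so the coproduct is needed with the last letter split off. -/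
theorem lowerWord_append_singleton {v : K} (hv : v ≠ 0) (w : List ℤˣ) (i : ℤˣ) :
    lowerWord v (w ++ [i])
      = v ^ (-(i : ℤ)) • (lowerWord v w * y K i) + (w.map (y K)).prod * lowerLetter i := by
  induction w with
  | nil => simp [lowerWord, show Kinv v (1 : T K) = 1 by simpa [wordWeight] using Kinv_prod v []]
  | cons j w ih =>
    rw [List.cons_append, lowerWord, ih, Kinv_prod, lowerWord, Kinv_prod]
    have h : v ^ (-wordWeight (w ++ [i])) = v ^ (-(i : ℤ)) * v ^ (-wordWeight w) := by
      rw [← zpow_add₀ hv]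
      congr 1
      simp [wordWeight]
    rw [h]
    simp only [List.map_append, List.map_cons, List.map_nil, List.prod_append, List.prod_cons,
      List.prod_nil, mul_one, mul_add, add_mul, smul_add, mul_smul_comm, smul_mul_assoc, mul_assoc,
      mul_smul, add_assoc]

theorem F_mul_y {v : K} (hv : v ≠ 0) (b : T K) (i : ℤˣ) :
    F v (b * y K i) = v ^ (-(i : ℤ)) • (F v b * y K i) + b * lowerLetter i := by
  have h : F v ∘ₗ LinearMap.mulRight K (y K i)
      = v ^ (-(i : ℤ)) • (LinearMap.mulRight K (y K i) ∘ₗ F v)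
        + LinearMap.mulRight K (lowerLetter i) := by
    refine (wordBasis K).ext fun w => ?_
    obtain ⟨w, rfl⟩ := FreeMonoid.ofList.surjective w
    have := lowerWord_append_singleton hv w i
    rw [← F_prod, ← F_prod] at this
    simpa [wordBasis_ofList] using this
  simpa using LinearMap.congr_fun h b

theorem F_mul_y_one {v : K} (hv : v ≠ 0) (b : T K) :
    F v (b * y K 1) = v⁻¹ • (F v b * y K 1) + b * y K (-1) := by
  simpa [lowerLetter] using F_mul_y hv b 1

theorem F_mul_y_neg_one {v : K} (hv : v ≠ 0) (b : T K) :
    F v (b * y K (-1)) = v • (F v b * y K (-1)) := by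
  simpa [lowerLetter] using F_mul_y hv b (-1)

theorem contractLetter_one_F {v : K} (hv : v ≠ 0) (b : T K) :
    contractLetter K 1 (F v b) = v⁻¹ • F v (contractLetter K 1 b) := by
  have h : contractLetter K 1 ∘ₗ F v = v⁻¹ • (F v ∘ₗ contractLetter K 1) := by
    refine hom_ext_right ?_ fun b i => ?_
    · simp [F_one, contractLetter_one]
    · obtain rfl | rfl := Int.units_eq_one_or i
      · simp [F_mul_y_one hv, contractLetter_mul_y]
      · simp [F_mul_y_neg_one hv, contractLetter_mul_y]
  exact LinearMap.congr_fun h b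

/-- The extra term records `F y₁ = y₋₁` on the last factor; no such term occurs for contraction with
`y₁`, since `F` never creates a `y₁`. -/
theorem contractLetter_neg_one_F {v : K} (hv : v ≠ 0) (b : T K) :
    contractLetter K (-1) (F v b)
      = v • F v (contractLetter K (-1) b) + contractLetter K 1 b := by
  have h : contractLetter K (-1) ∘ₗ F v
      = v • (F v ∘ₗ contractLetter K (-1)) + contractLetter K 1 := by
    refine hom_ext_right ?_ fun b i => ?_
    · simp [F_one, contractLetter_one]
    · obtain rfl | rfl := Int.units_eq_one_or i
      · simp [F_mul_y_one hv, contractLetter_mul_y]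
      · simp [F_mul_y_neg_one hv, contractLetter_mul_y]
  exact LinearMap.congr_fun h b

theorem form_one_mul_y (b : T K) (i : ℤˣ) : form K 1 (b * y K i) = 0 := by
  have h : form K 1 ∘ₗ LinearMap.mulRight K (y K i) = 0 := by
    refine (wordBasis K).ext fun w => ?_
    rw [LinearMap.comp_apply, LinearMap.mulRight_apply, ← wordBasis_mul_of, ← wordBasis_one,
      form_wordBasis, if_neg, LinearMap.zero_apply]
    intro h
    simpa using congrArg FreeMonoid.length h
  exact LinearMap.congr_fun h b

theorem form_one_F {v : K} (hv : v ≠ 0) (b : T K) : form K 1 (F v b) = 0 := by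
  have h : form K 1 ∘ₗ F v = 0 := by
    refine hom_ext_right ?_ fun b i => ?_
    · simp [F_one]
    · obtain rfl | rfl := Int.units_eq_one_or i
      · simp [F_mul_y_one hv, form_one_mul_y]
      · simp [F_mul_y_neg_one hv, form_one_mul_y]
  exact LinearMap.congr_fun h b

theorem form_one_one : form K 1 1 = 1 := by
  rw [← wordBasis_one, form_wordBasis, if_pos rfl]

theorem contract_Psi (v : K) (x b : T K) :
    contract K (Psi v x) b
      = contractLetter K 1 (contract K x (contractLetter K (-1) b))
        - v • contractLetter K (-1) (contract K x (contractLetter K 1 b)) := by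
  simp [Psi, contract_y]

/-- Contraction with `Ψ(x)` commutes with `F` if contraction with `x` does. -/
theorem contract_Psi_F {v : K} (hv : v ≠ 0) {x : T K}
    (hx : ∀ b, contract K x (F v b) = F v (contract K x b)) (b : T K) :
    contract K (Psi v x) (F v b) = F v (contract K (Psi v x) b) := by
  -- Each half of `Ψ` leaves one extra term, contraction with `y₁ ⊗ x ⊗ y₁`. They cancel precisely
  -- because of the coefficient `-v` in `Ψ`.
  simp only [contract_Psi, contractLetter_one_F hv, contractLetter_neg_one_F hv, map_add, map_smul,
    map_sub, hx, smul_add, smul_smul, mul_inv_cancel₀ hv, one_smul]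
  rw [inv_mul_cancel₀ hv, mul_one]
  abel

end TensorSpace

/-! ### Lattice paths: heights, pairings and compatibility on intervals. -/

section Heights

/-- The sum of the first `k` entries of an infinite sequence of signs. -/
def height (a : ℕ → ℤˣ) (k : ℕ) : ℤ := ∑ t ∈ Finset.range k, (a t : ℤ)

/-- `(i, j)` is a pair of paired indices of an infinite sequence of signs. -/
def IsPair (a : ℕ → ℤˣ) (i j : ℕ) : Prop :=
  a i = 1 ∧ i < j ∧ height a (j + 1) = height a i ∧
    ∀ k, i < k → k < j → height a (k + 1) ≠ height a i

/-- The entries of `b` at each pair of paired indices of `a` in `[p, q)` have opposite signs. -/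
def CompatibleOn (a b : ℕ → ℤˣ) (p q : ℕ) : Prop :=
  ∀ i j, p ≤ i → j < q → IsPair a i j → b i = -b j

variable {a b : ℕ → ℤˣ} {i j p q : ℕ}

theorem height_succ (a : ℕ → ℤˣ) (k : ℕ) : height a (k + 1) = height a k + a k :=
  Finset.sum_range_succ _ _

theorem height_succ_of_eq_one (h : a i = 1) : height a (i + 1) = height a i + 1 := by
  rw [height_succ, h]; rfl

theorem height_succ_of_eq_neg_one (h : a i = -1) : height a (i + 1) = height a i - 1 := by
  rw [height_succ, h]; rfl

/-- The path starts one above its base level, moves by unit steps, and cannot meet that level before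
the pair closes. -/
theorem IsPair.lt_height (h : IsPair a i j) {k : ℕ} (hik : i < k) (hkj : k ≤ j) :
    height a i < height a k := by
  obtain ⟨h1, -, -, h2⟩ := h
  induction k, hik using Nat.le_induction with
  | base => rw [Nat.succ_eq_add_one, height_succ_of_eq_one h1]; omega
  | succ k hk ih =>
    have h3 := h2 k hk (by omega)
    have h4 := ih (by omega)
    rcases Int.units_eq_one_or (a k) with h | h
    · rw [height_succ_of_eq_one h] at *; omega
    · rw [height_succ_of_eq_neg_one h] at *; omega

theorem IsPair.right_eq (h : IsPair a i j) : a j = -1 := by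
  refine (Int.units_eq_one_or (a j)).resolve_left fun h1 => ?_
  have h2 := h.lt_height h.2.1 le_rfl
  have h3 := h.2.2.1
  rw [height_succ_of_eq_one h1] at h3
  omega

/-- An index is the right end of at most one pairing. -/
theorem IsPair.left_unique {i' : ℕ} (h : IsPair a i j) (h' : IsPair a i' j) : i = i' := by
  rcases lt_trichotomy i i' with hlt | heq | hlt
  · have := h.lt_height hlt h'.2.1.le
    have := h.2.2.1
    have := h'.2.2.1
    omega
  · exact heq
  · have := h'.lt_height hlt h.2.1.le
    have := h.2.2.1
    have := h'.2.2.1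
    omega

theorem exists_isPair (hp : p ≤ q) (ha : a q = -1) (h : height a p ≤ height a (q + 1)) :
    ∃ i, p ≤ i ∧ IsPair a i q := by
  have hq := height_succ_of_eq_neg_one ha
  -- The partner is the last position up to `q` at which the path is no higher than after `q`;
  -- position `p` shows that one exists.
  let i := Nat.findGreatest (fun k => height a k ≤ height a (q + 1)) q
  have hi : height a i ≤ height a (q + 1) :=
    Nat.findGreatest_spec (P := fun k => height a k ≤ height a (q + 1)) hp h
  have hpi : p ≤ i := Nat.le_findGreatest hp h
  have hiq : i ≤ q := Nat.findGreatest_le q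
  have hgt : ∀ k, i < k → k ≤ q → height a (q + 1) < height a k := fun k h1 h2 =>
    not_le.1 (Nat.findGreatest_is_greatest h1 h2)
  have hne : i ≠ q := fun e => by rw [e] at hi; omega
  have h1 := hgt (i + 1) (by omega) (by omega)
  rcases Int.units_eq_one_or (a i) with hai | hai
  · have h2 := height_succ_of_eq_one hai
    refine ⟨i, hpi, hai, by omega, by omega, fun k hk1 hk2 => ?_⟩
    have := hgt (k + 1) (by omega) (by omega)
    omega
  · have h2 := height_succ_of_eq_neg_one hai
    omega

theorem compatibleOn_self : CompatibleOn a b p p := fun _ _ h1 h2 h => by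
  have := h.2.1
  omega

theorem compatibleOn_succ_of_eq_one (ha : a q = 1) :
    CompatibleOn a b p (q + 1) ↔ CompatibleOn a b p q := by
  refine ⟨fun h i j hi hj => h i j hi (by omega), fun h i j hi hj hij => ?_⟩
  rcases Nat.lt_succ_iff_lt_or_eq.1 hj with hj | rfl
  · exact h i j hi hj hij
  · exact absurd (hij.right_eq.symm.trans ha) (by decide)

/-- Links do not cross: a pair straddling `i` would have to return to a level below `height a i`
before the link at `i` closes. So every other pair lies wholly to the left of `i` or wholly inside
the link. -/
theorem IsPair.compatibleOn_iff (h : IsPair a i q) (hp : p ≤ i) :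
    CompatibleOn a b p (q + 1) ↔
      CompatibleOn a b p i ∧ CompatibleOn a b (i + 1) q ∧ b i = -b q := by
  have hiq := h.2.1
  constructor
  · exact fun H => ⟨fun r s hr hs => H r s hr (by omega),
      fun r s hr hs => H r s (by omega) (by omega), H i q hp (by omega) h⟩
  · rintro ⟨h1, h2, h3⟩ r s hr hs hrs
    rcases Nat.lt_succ_iff_lt_or_eq.1 hs with hs | rfl
    · rcases lt_trichotomy s i with hsi | rfl | hsi
      · exact h1 r s hr hsi hrs
      · exact absurd (hrs.right_eq.symm.trans h.1) (by decide)
      · rcases lt_trichotomy r i with hri | rfl | hri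
        · have := hrs.lt_height hri hsi.le
          have := h.lt_height (show i < s + 1 by omega) hs
          have := hrs.2.2.1
          omega
        · exact absurd hrs.2.2.1 (h.2.2.2 s hsi hs)
        · exact h2 r s hri hs hrs
    · rw [← h.left_unique hrs]; exact h3

end Heights

/-! ### Passage from finite sequences to intervals of infinite ones. -/

section Intervals

theorem partialSum_eq_height (a : ℕ → ℤˣ) {l k : ℕ} (hk : k ≤ l) :
    partialSum (fun i : Fin l => a i) k = height a k := by
  rw [partialSum, height, Finset.sum_filter,
    Fin.sum_univ_eq_sum_range (fun i => if i < k then (a i : ℤ) else 0) l, ← Finset.sum_filter]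
  refine Finset.sum_congr ?_ fun _ _ => rfl
  ext t
  simp only [Finset.mem_filter, Finset.mem_range]
  omega

theorem sum_Icc_eq_height_sub (a : ℕ → ℤˣ) (p : ℕ) {l : ℕ} {i j : Fin l} (h : i ≤ j) :
    ∑ k ∈ Finset.Icc i j, (a (p + k) : ℤ) = height a (p + j + 1) - height a (p + i) := by
  have h1 : ∑ k ∈ Finset.Icc i j, (a (p + k) : ℤ)
      = ∑ k ∈ Finset.Icc (i : ℕ) j, (a (p + k) : ℤ) := by
    rw [← Fin.map_valEmbedding_Icc, Finset.sum_map]; rfl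
  rw [h1, height, height, ← Finset.sum_Ico_eq_sub _ (by have := Fin.le_def.1 h; omega),
    Finset.sum_Ico_eq_sum_range, ← Finset.Ico_add_one_right_eq_Icc, Finset.sum_Ico_eq_sum_range]
  refine Finset.sum_congr (by congr 1; omega) fun t _ => by rw [add_assoc]

/-- Being paired depends only on height differences between the two ends, so it is insensitive to
the interval to which the sequence is restricted. -/
theorem paired_iff_isPair (a : ℕ → ℤˣ) (p : ℕ) {l : ℕ} (i j : Fin l) :
    Paired (fun k : Fin l => a (p + k)) i j ↔ IsPair a (p + i) (p + j) := by
  constructor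
  · rintro ⟨h1, ⟨h2, h3⟩, h4⟩
    refine ⟨h1, by have := Fin.lt_def.1 h2; omega, ?_, fun k hk1 hk2 h5 => ?_⟩
    · rw [sum_Icc_eq_height_sub a p h2.le] at h3; omega
    · let k' : Fin l := ⟨k - p, by omega⟩
      have hk' : p + (k' : ℕ) = k := by simp only [k']; omega
      have hik : i < k' := by rw [Fin.lt_def]; omega
      have := h4 ⟨hik, by rw [sum_Icc_eq_height_sub a p hik.le, hk', h5, sub_self]⟩
      rw [Fin.le_def] at this
      omega
  · rintro ⟨h1, h2, h3, h4⟩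
    have hij : i < j := by rw [Fin.lt_def]; omega
    refine ⟨h1, ⟨hij, by rw [sum_Icc_eq_height_sub a p hij.le, h3, sub_self]⟩, ?_⟩
    rintro k ⟨hik, hk⟩
    rw [sum_Icc_eq_height_sub a p hik.le] at hk
    by_contra hlt
    have hlt' := Fin.lt_def.1 (not_le.1 hlt)
    exact h4 (p + k) (by have := Fin.lt_def.1 hik; omega) (by omega) (by omega)

variable {K : Type*} [Field K]

theorem natVec_congr (v : K) {l l' : ℕ} (h : l = l') {α : Fin l → ℤˣ} {α' : Fin l' → ℤˣ}
    (hα : ∀ k (hk : k < l) (hk' : k < l'), α ⟨k, hk⟩ = α' ⟨k, hk'⟩) :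
    natVec v α = natVec v α' := by
  subst h
  congr 1
  funext k
  exact hα k k.2 k.2

/-- The vector `N` of the restriction of an infinite sequence to the interval `[p, q)`. -/
noncomputable def natVecOn (v : K) (a : ℕ → ℤˣ) (p q : ℕ) : T K :=
  natVec v fun k : Fin (q - p) => a (p + k)

variable (v : K) {a : ℕ → ℤˣ} {i p q : ℕ}

theorem natVecOn_self (a : ℕ → ℤˣ) (p : ℕ) : natVecOn v a p p = 1 := by
  rw [natVecOn, natVec_congr v (Nat.sub_self p) (α' := fun k => a (p + k)) fun _ _ _ => rfl, natVec]

theorem natVecOn_succ_eq (hp : p ≤ q) :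
    natVecOn v a p (q + 1) = natVec v fun k : Fin (q - p + 1) => a (p + k) :=
  natVec_congr v (by omega) fun _ _ _ => rfl

theorem natVecOn_succ_of_eq_one (hp : p ≤ q) (ha : a q = 1) :
    natVecOn v a p (q + 1) = natVecOn v a p q * y K 1 := by
  rw [natVecOn_succ_eq v hp, natVec, if_pos]
  · rfl
  · simpa [Nat.add_sub_cancel' hp] using ha

theorem natVecOn_succ_of_isPair (hp : p ≤ i) (h : IsPair a i q) :
    natVecOn v a p (q + 1) = natVecOn v a p i * Psi v (natVecOn v a (i + 1) q) := by
  have hiq := h.2.1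
  have hq : p + (Fin.last (q - p) : ℕ) = q := by rw [Fin.val_last]; omega
  have hex : ∃ r : Fin (q - p + 1),
      Paired (fun k : Fin (q - p + 1) => a (p + k)) r (Fin.last (q - p)) := by
    refine ⟨⟨i - p, by omega⟩, (paired_iff_isPair a p _ _).2 ?_⟩
    rw [hq]
    simpa [Nat.add_sub_cancel' hp] using h
  -- The partner chosen in `natVec` is the given one, by uniqueness of left ends.
  have hch : p + (hex.choose : ℕ) = i := by
    have := (paired_iff_isPair a p _ _).1 hex.choose_spec
    rw [hq] at this
    exact this.left_unique h
  rw [natVecOn_succ_eq v (by omega), natVec, if_neg, dif_pos hex]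
  · congr 1
    · exact natVec_congr v (by omega) fun _ _ _ => rfl
    · congr 1
      exact natVec_congr v (by omega) fun k _ _ => congrArg a (by simp only; omega)
  · simp only [hq, h.right_eq]
    decide

/-- The vector `ω` of the restriction of an infinite sequence to its first `k` entries. -/
noncomputable def omegaPrefix (b : ℕ → ℤˣ) (k : ℕ) : T K := omegaVec v fun i : Fin k => b i

theorem omegaPrefix_zero (b : ℕ → ℤˣ) : omegaPrefix v b 0 = 1 := rfl

theorem omegaPrefix_succ_of_eq_one {b : ℕ → ℤˣ} (h : b q = 1) :
    omegaPrefix v b (q + 1) = omegaPrefix v b q * y K 1 := by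
  rw [omegaPrefix, omegaVec, if_pos (by simpa using h)]
  rfl

theorem omegaPrefix_succ_of_eq_neg_one {b : ℕ → ℤˣ} (h : b q = -1) :
    omegaPrefix v b (q + 1) = qInt v (height b q) • (omegaPrefix v b q * y K (-1))
      - v ^ height b q • (F v (omegaPrefix v b q) * y K 1) := by
  have hs : ∑ i, (Fin.init (fun i : Fin (q + 1) => b i) i : ℤ) = height b q := by
    rw [height, ← Fin.sum_univ_eq_sum_range (fun i => (b i : ℤ))]; rfl
  rw [omegaPrefix, omegaVec, if_neg (by simp [h]), hs]
  rfl

end Intervals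

/-! ### Contracting `ω(β)` with the blocks of `N(α)`. -/

section Contraction

variable {K : Type*} [Field K] {v : K} {a b : ℕ → ℤˣ} {i p q : ℕ}

/-- The factor contributed by position `j` to the pairing of `N` and `ω`. -/
noncomputable def pairingFactor (v : K) (a b : ℕ → ℤˣ) (j : ℕ) : K :=
  if b j = -1 then v * qInt v (if a j = 1 then -height b j else height b j + 1) else 1

/-- The product of the factors contributed by the positions in `[p, q)`. -/
noncomputable def pairingProd (v : K) (a b : ℕ → ℤˣ) (p q : ℕ) : K :=
  ∏ j ∈ Finset.Ico p q, pairingFactor v a b j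

theorem pairingProd_self : pairingProd v a b p p = 1 := by simp [pairingProd]

theorem pairingProd_mul {r : ℕ} (hpq : p ≤ q) (hqr : q ≤ r) :
    pairingProd v a b p q * pairingProd v a b q r = pairingProd v a b p r :=
  Finset.prod_Ico_consecutive _ hpq hqr

theorem pairingProd_succ (hpq : p ≤ q) :
    pairingProd v a b p (q + 1) = pairingProd v a b p q * pairingFactor v a b q :=
  Finset.prod_Ico_succ_top hpq _

/-- A nonnegative sequence on `[p, q)` is decomposed along its last entry. -/
theorem interval_induction {P : ℕ → Prop}
    (self : P p)
    (defect : ∀ q, p ≤ q → a q = 1 → (∀ k, p ≤ k → k ≤ q → height a p ≤ height a k) → P q →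
      P (q + 1))
    (pair : ∀ i q, p ≤ i → IsPair a i q →
      (∀ k, p ≤ k → k ≤ q + 1 → height a p ≤ height a k) → P i → P (q + 1))
    (q : ℕ) (hpq : p ≤ q) (h : ∀ k, p ≤ k → k ≤ q → height a p ≤ height a k) : P q := by
  induction q using Nat.strong_induction_on with
  | _ q ih =>
    rcases hpq.eq_or_lt with rfl | hlt
    · exact self
    · obtain ⟨r, rfl⟩ := Nat.exists_eq_succ_of_ne_zero (show q ≠ 0 by omega)
      rcases Int.units_eq_one_or (a r) with hr | hr
      · exact defect r (by omega) hr (fun k h1 h2 => h k h1 (by omega))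
          (ih r (by omega) (by omega) fun k h1 h2 => h k h1 (by omega))
      · obtain ⟨i, hi, hir⟩ := exists_isPair (show p ≤ r by omega) hr (h _ (by omega) le_rfl)
        have := hir.2.1
        exact pair i r hi hir h (ih i (by omega) hi fun k h1 h2 => h k h1 (by omega))

/-- A sequence which is balanced on `[p, q)` is decomposed along the pairings of the entries
which lie in no other pair, and recursively inside these pairings. -/
theorem balanced_induction {P : ℕ → ℕ → Prop}
    (self : ∀ p, P p p)
    (pair : ∀ p i q, p ≤ i → IsPair a i q → P p i → P (i + 1) q → P p (q + 1))
    (p q : ℕ) (hpq : p ≤ q) (h : ∀ k, p ≤ k → k ≤ q → height a p ≤ height a k)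
    (hq : height a q = height a p) : P p q := by
  induction hn : q - p using Nat.strong_induction_on generalizing p q with
  | _ n ih =>
    rcases hpq.eq_or_lt with rfl | hlt
    · exact self p
    · obtain ⟨r, rfl⟩ := Nat.exists_eq_succ_of_ne_zero (show q ≠ 0 by omega)
      rw [Nat.succ_eq_add_one] at *
      rcases Int.units_eq_one_or (a r) with hr | hr
      · have := height_succ_of_eq_one hr
        have := h r (by omega) (by omega)
        omega
      · obtain ⟨i, hi, hir⟩ := exists_isPair (show p ≤ r by omega) hr (h _ (by omega) le_rfl)
        have h1 := hir.2.1
        have h2 := hir.2.2.1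
        have h3 := height_succ_of_eq_one hir.1
        have h4 := height_succ_of_eq_neg_one hr
        refine pair p i r hi hir
          (ih _ (by omega) p i hi (fun k hk hk' => h k hk (by omega)) (by omega) rfl)
          (ih _ (by omega) (i + 1) r h1 (fun k hk hk' => ?_) (by omega) rfl)
        have := hir.lt_height hk hk'
        omega

theorem IsPair.inner_balanced (h : IsPair a i q) :
    (∀ k, i + 1 ≤ k → k ≤ q → height a (i + 1) ≤ height a k) ∧
      height a q = height a (i + 1) := by
  have h3 := height_succ_of_eq_one h.1
  have h4 := height_succ_of_eq_neg_one h.right_eq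
  have h2 := h.2.2.1
  refine ⟨fun k hk hk' => ?_, by omega⟩
  have := h.lt_height hk hk'
  omega

/-- Contraction with `N(γ)` commutes with `F` if `γ` has no defects. -/
theorem contract_natVecOn_F (hv : v ≠ 0) (p q : ℕ) (hpq : p ≤ q)
    (h : ∀ k, p ≤ k → k ≤ q → height a p ≤ height a k) (hq : height a q = height a p) :
    ∀ x, contract K (natVecOn v a p q) (F v x) = F v (contract K (natVecOn v a p q) x) := by
  refine balanced_induction (a := a) (P := fun p q => ∀ x, contract K (natVecOn v a p q) (F v x)
    = F v (contract K (natVecOn v a p q) x)) ?_ ?_ p q hpq h hq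
  · intro p x
    simp [natVecOn_self]
  · intro p i q hp hiq h1 h2 x
    rw [natVecOn_succ_of_isPair v hp hiq, map_mul, Module.End.mul_apply, Module.End.mul_apply,
      contract_Psi_F hv h2, h1]

/-- The effect on `ω(β)` of contraction with a vector nested inside a link. -/
theorem contract_Psi_omegaPrefix (hv : v ≠ 0) (hiq : IsPair a i q)
    (hc : CompatibleOn a b (i + 1) q → height b q = height b (i + 1) ∧
      contract K (natVecOn v a (i + 1) q) (omegaPrefix v b q)
        = pairingProd v a b (i + 1) q • omegaPrefix v b (i + 1))
    (hn : ¬ CompatibleOn a b (i + 1) q →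
      contract K (natVecOn v a (i + 1) q) (omegaPrefix v b q) = 0) :
    (CompatibleOn a b (i + 1) q ∧ b i = -b q → height b (q + 1) = height b i ∧
      contract K (Psi v (natVecOn v a (i + 1) q)) (omegaPrefix v b (q + 1))
        = pairingProd v a b i (q + 1) • omegaPrefix v b i) ∧
    (¬ (CompatibleOn a b (i + 1) q ∧ b i = -b q) →
      contract K (Psi v (natVecOn v a (i + 1) q)) (omegaPrefix v b (q + 1)) = 0) := by
  -- When `b q = -1`, the last step of `ω` involves `F`; commuting `C` past `F` reduces that term to
  -- the known contraction of the prefix of length `q`.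
  have hF := contract_natVecOn_F hv (i + 1) q hiq.2.1 hiq.inner_balanced.1 hiq.inner_balanced.2
  have hprod : pairingProd v a b i (q + 1)
      = pairingFactor v a b i * pairingProd v a b (i + 1) q * pairingFactor v a b q := by
    rw [pairingProd_succ hiq.2.1.le, ← pairingProd_mul (Nat.le_succ i) hiq.2.1,
      pairingProd_succ le_rfl, pairingProd_self, one_mul]
  have hai := hiq.1
  have haq : a q ≠ 1 := by rw [hiq.right_eq]; decide
  rw [contract_Psi, hprod]
  set C := contract K (natVecOn v a (i + 1) q)
  set c := pairingProd v a b (i + 1) q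
  set w := omegaPrefix v b i
  have hne : (1 : ℤˣ) ≠ -1 := by decide
  by_cases hcomp : CompatibleOn a b (i + 1) q
  · obtain ⟨hh, hC⟩ := hc hcomp
    rcases Int.units_eq_one_or (b q) with hq | hq <;> rcases Int.units_eq_one_or (b i) with hi | hi
    · refine ⟨fun h => absurd (hi.symm.trans (h.2.trans (by rw [hq]))) hne, fun _ => ?_⟩
      rw [omegaPrefix_succ_of_eq_one v hq]
      simp [contractLetter_mul_y, hne, hC, omegaPrefix_succ_of_eq_one v hi]
    · refine ⟨fun _ => ⟨?_, ?_⟩, fun h => absurd ⟨hcomp, by rw [hi, hq]⟩ h⟩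
      · rw [height_succ_of_eq_one hq, hh, height_succ_of_eq_neg_one hi]; ring
      · rw [omegaPrefix_succ_of_eq_one v hq]
        simp [contractLetter_mul_y, hne, hC, omegaPrefix_succ_of_eq_neg_one v hi, pairingFactor,
          hi, hq, hai, qInt_neg, smul_smul]
        congr 1
        ring
    -- With `h = height b q`, the two halves of `Ψ` contribute `[h]` and `v^(h+1)`, which add up to
    -- `v[h+1]`.
    · have hs : height b q = height b i + 1 := by rw [hh, height_succ_of_eq_one hi]
      refine ⟨fun _ => ⟨?_, ?_⟩, fun h => absurd ⟨hcomp, by rw [hi, hq, neg_neg]⟩ h⟩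
      · rw [height_succ_of_eq_neg_one hq, hs]; ring
      · rw [omegaPrefix_succ_of_eq_neg_one v hq]
        simp [contractLetter_mul_y, hne, hne.symm, hC, hF, omegaPrefix_succ_of_eq_one v hi,
          pairingFactor, hi, hq, haq, smul_smul, F_mul_y_one hv, mul_qInt_add_one hv]
        rw [← add_smul]
        congr 1
        rw [zpow_add_one₀ hv]
        ring
    -- All terms are multiples of `F w`; with `h = height b q`, their sum is proportional to `v[h+1]
    -- - [h] - v^(h+1) = 0`.
    · have hs : height b i = height b q + 1 := by rw [hh, height_succ_of_eq_neg_one hi]; ring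
      refine ⟨fun h => absurd (h.2.symm.trans hi) (by rw [hq]; decide), fun _ => ?_⟩
      rw [omegaPrefix_succ_of_eq_neg_one v hq]
      simp [contractLetter_mul_y, hne, hne.symm, hC, hF, omegaPrefix_succ_of_eq_neg_one v hi,
        smul_smul, F_mul_y_one hv, F_mul_y_neg_one hv]
      rw [hs]
      have := mul_qInt_add_one hv (height b q)
      rw [← sub_smul, smul_smul, ← neg_smul, ← add_smul]
      refine (congrArg (· • _) ?_).trans (zero_smul K _)
      rw [zpow_add_one₀ hv] at this ⊢
      linear_combination (v * v ^ height b q * c) * this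
  · have hC := hn hcomp
    refine ⟨fun h => absurd h.1 hcomp, fun _ => ?_⟩
    rcases Int.units_eq_one_or (b q) with hq | hq
    · rw [omegaPrefix_succ_of_eq_one v hq]
      simp [contractLetter_mul_y, hne, hC]
    · rw [omegaPrefix_succ_of_eq_neg_one v hq]
      simp [contractLetter_mul_y, hne, hne.symm, hC, hF]

/-- Contraction of `ω(β)` with `N(γ)`, where `γ` has no defects and occupies the last positions. -/
theorem contract_natVecOn_omegaPrefix (hv : v ≠ 0) (p q : ℕ) (hpq : p ≤ q)
    (h : ∀ k, p ≤ k → k ≤ q → height a p ≤ height a k) (hq : height a q = height a p) :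
    p ≤ q ∧ (CompatibleOn a b p q → height b q = height b p ∧
      contract K (natVecOn v a p q) (omegaPrefix v b q)
        = pairingProd v a b p q • omegaPrefix v b p) ∧
    (¬ CompatibleOn a b p q →
      contract K (natVecOn v a p q) (omegaPrefix v b q) = 0) := by
  refine balanced_induction (a := a) (P := fun p q => p ≤ q ∧ (CompatibleOn a b p q →
    height b q = height b p ∧ contract K (natVecOn v a p q) (omegaPrefix v b q)
      = pairingProd v a b p q • omegaPrefix v b p) ∧ (¬ CompatibleOn a b p q →
      contract K (natVecOn v a p q) (omegaPrefix v b q) = 0)) ?_ ?_ p q hpq h hq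
  · intro p
    refine ⟨le_rfl, fun _ => ⟨rfl, ?_⟩, fun h => absurd compatibleOn_self h⟩
    simp [natVecOn_self, pairingProd_self]
  · rintro p i q hp hiq ⟨-, h1, h1'⟩ ⟨-, h2, h2'⟩
    have hlt := hiq.2.1
    obtain ⟨h3, h3'⟩ := contract_Psi_omegaPrefix hv hiq h2 h2'
    rw [natVecOn_succ_of_isPair v hp hiq, map_mul, Module.End.mul_apply, hiq.compatibleOn_iff hp]
    refine ⟨by omega, fun ⟨hc1, hc2⟩ => ?_, fun hc => ?_⟩
    · obtain ⟨h4, h5⟩ := h3 hc2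
      obtain ⟨h6, h7⟩ := h1 hc1
      refine ⟨h4.trans h6, ?_⟩
      rw [h5, map_smul, h7, smul_smul, mul_comm, pairingProd_mul hp (by omega)]
    · by_cases hc2 : CompatibleOn a b (i + 1) q ∧ b i = -b q
      · rw [(h3 hc2).2, map_smul, h1' fun hc1 => hc ⟨hc1, hc2⟩, smul_zero]
      · rw [h3' hc2, map_zero]

/-- The one-link computation with its assumptions on the inside of the link now discharged by the
induction over balanced intervals. -/
theorem IsPair.contract_Psi_omegaPrefix (hv : v ≠ 0) (hiq : IsPair a i q) :
    (CompatibleOn a b (i + 1) q ∧ b i = -b q → height b (q + 1) = height b i ∧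
      contract K (Psi v (natVecOn v a (i + 1) q)) (omegaPrefix v b (q + 1))
        = pairingProd v a b i (q + 1) • omegaPrefix v b i) ∧
    (¬ (CompatibleOn a b (i + 1) q ∧ b i = -b q) →
      contract K (Psi v (natVecOn v a (i + 1) q)) (omegaPrefix v b (q + 1)) = 0) :=
  have h := contract_natVecOn_omegaPrefix hv (i + 1) q hiq.2.1 hiq.inner_balanced.1
    hiq.inner_balanced.2
  TLTensor.contract_Psi_omegaPrefix hv hiq h.2.1 h.2.2

/-- `N(α)` is orthogonal to the image of `F`. -/
theorem form_natVecOn_F (hv : v ≠ 0) (q : ℕ) (h : ∀ k ≤ q, 0 ≤ height a k) :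
    ∀ x, form K 1 (contract K (natVecOn v a 0 q) (F v x)) = 0 := by
  refine interval_induction (p := 0) (a := a)
    (P := fun q => ∀ x, form K 1 (contract K (natVecOn v a 0 q) (F v x)) = 0)
    ?_ ?_ ?_ q (Nat.zero_le q) fun k _ hk => h k hk
  · intro x
    simp [natVecOn_self, form_one_F hv]
  · intro q _ hq _ ih x
    rw [natVecOn_succ_of_eq_one v (Nat.zero_le q) hq, map_mul, Module.End.mul_apply, contract_y,
      contractLetter_one_F hv, map_smul, map_smul, ih, smul_zero]
  · intro i q _ hiq _ ih x
    rw [natVecOn_succ_of_isPair v (Nat.zero_le i) hiq, map_mul, Module.End.mul_apply,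
      contract_Psi_F hv (contract_natVecOn_F hv (i + 1) q hiq.2.1 hiq.inner_balanced.1
        hiq.inner_balanced.2), ih]

/-- The pairing of `N(α)` and `ω(β)`, for a 1-factor `α` and an arbitrary sequence `β`. -/
theorem form_natVecOn_omegaPrefix (hv : v ≠ 0) (q : ℕ) (h : ∀ k ≤ q, 0 ≤ height a k) :
    (CompatibleOn a b 0 q → height b q ≤ height a q) ∧
    (CompatibleOn a b 0 q → height b q = height a q →
      form K 1 (contract K (natVecOn v a 0 q) (omegaPrefix v b q)) = pairingProd v a b 0 q) ∧
    (¬ (CompatibleOn a b 0 q ∧ height b q = height a q) →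
      form K 1 (contract K (natVecOn v a 0 q) (omegaPrefix v b q)) = 0) := by
  refine interval_induction (p := 0) (a := a)
    (P := fun q => (CompatibleOn a b 0 q → height b q ≤ height a q) ∧
      (CompatibleOn a b 0 q → height b q = height a q →
        form K 1 (contract K (natVecOn v a 0 q) (omegaPrefix v b q)) = pairingProd v a b 0 q) ∧
      (¬ (CompatibleOn a b 0 q ∧ height b q = height a q) →
        form K 1 (contract K (natVecOn v a 0 q) (omegaPrefix v b q)) = 0))
    ?_ ?_ ?_ q (Nat.zero_le q) fun k _ hk => h k hk
  · refine ⟨fun _ => le_rfl, fun _ _ => ?_, fun h => absurd ⟨compatibleOn_self, rfl⟩ h⟩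
    simp [natVecOn_self, pairingProd_self, omegaPrefix_zero, form_one_one]
  · rintro q - hq hpos ⟨ih1, ih2, ih3⟩
    rw [natVecOn_succ_of_eq_one v (Nat.zero_le q) hq, map_mul, Module.End.mul_apply, contract_y,
      compatibleOn_succ_of_eq_one hq, height_succ_of_eq_one hq, pairingProd_succ (Nat.zero_le q)]
    rcases Int.units_eq_one_or (b q) with hb | hb
    · rw [height_succ_of_eq_one hb, omegaPrefix_succ_of_eq_one v hb, contractLetter_mul_y,
        if_pos rfl, pairingFactor, if_neg (by rw [hb]; decide), mul_one, add_left_inj]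
      exact ⟨fun hc => by have := ih1 hc; omega, ih2, ih3⟩
    -- A `-1` of `β` at a defect puts its height strictly below that of `α`, so the equal-height
    -- claim is vacuous; the pairing vanishes because only an `F`-image survives contraction with
    -- `y₁`.
    · rw [height_succ_of_eq_neg_one hb]
      refine ⟨fun hc => by have := ih1 hc; omega, fun hc he => ?_, fun _ => ?_⟩
      · have := ih1 hc
        omega
      · rw [omegaPrefix_succ_of_eq_neg_one v hb]
        have hne : (-1 : ℤˣ) ≠ 1 := by decide
        simp [contractLetter_mul_y, hne,
          form_natVecOn_F hv q fun k hk => hpos k (Nat.zero_le k) hk]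
  · rintro i q - hiq - ⟨ih1, ih2, ih3⟩
    have hlt := hiq.2.1
    obtain ⟨h3, h3'⟩ := hiq.contract_Psi_omegaPrefix (b := b) hv
    rw [natVecOn_succ_of_isPair v (Nat.zero_le i) hiq, map_mul, Module.End.mul_apply,
      hiq.compatibleOn_iff (Nat.zero_le i), hiq.2.2.1]
    refine ⟨fun ⟨hc1, hc2⟩ => (h3 hc2).1.trans_le (ih1 hc1), fun ⟨hc1, hc2⟩ he => ?_, fun hc => ?_⟩
    · obtain ⟨h4, h5⟩ := h3 hc2
      rw [h5, map_smul, map_smul, ih2 hc1 (h4.symm.trans he), smul_eq_mul, mul_comm,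
        pairingProd_mul (Nat.zero_le i) (by omega)]
    · by_cases hc2 : CompatibleOn a b (i + 1) q ∧ b i = -b q
      · obtain ⟨h4, h5⟩ := h3 hc2
        rw [h5, map_smul, map_smul, ih3 fun hc1 => hc ⟨⟨hc1.1, hc2⟩, h4.trans hc1.2⟩, smul_zero]
      · rw [h3' hc2, map_zero, map_zero]

end Contraction

/-! ### Counting pairings, and translation back to finite sequences. -/

section Counting

variable {l : ℕ}

/-- The pairings of a 1-factor correspond to its entries `-1`. -/
theorem numPairings_eq_card (a : ℕ → ℤˣ) (h : ∀ k ≤ l, 0 ≤ height a k) :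
    numPairings (fun k : Fin l => a k)
      = (Finset.univ.filter fun k : Fin l => a k = -1).card := by
  have hp : ∀ i j : Fin l, Paired (fun k : Fin l => a k) i j ↔ IsPair a i j := fun i j => by
    simpa using paired_iff_isPair a 0 i j
  rw [numPairings, ← Set.ncard_coe_finset]
  refine Set.ncard_congr (fun x _ => x.2) ?_ ?_ ?_
  · rintro ⟨i, j⟩ hij
    simpa using ((hp i j).1 hij).right_eq
  · rintro ⟨i, j⟩ ⟨i', j'⟩ hij hij' rfl
    have := ((hp i j).1 hij).left_unique ((hp i' j).1 hij')
    rw [Fin.ext this]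
  · intro j hj
    have hj' : a j = -1 := by simpa using hj
    obtain ⟨i, -, hi⟩ := exists_isPair (Nat.zero_le j) hj' (h _ j.2)
    exact ⟨(⟨i, hi.2.1.trans j.2⟩, j), (hp _ _).2 hi, rfl⟩

/-- With `numPairings_eq_card`, this turns equality of the numbers of pairings into equality of
final heights. -/
theorem height_eq_sub_card (a : ℕ → ℤˣ) (l : ℕ) :
    height a l = l - 2 * (Finset.univ.filter fun k : Fin l => a k = -1).card := by
  rw [height, ← Fin.sum_univ_eq_sum_range (fun i => (a i : ℤ)), Finset.card_filter]
  have h : ∀ u : ℤˣ, (u : ℤ) = 1 - 2 * (if u = -1 then 1 else 0 : ℕ) := by decide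
  rw [Finset.sum_congr (rfl : (Finset.univ : Finset (Fin l)) = _) fun i _ => h (a i), Finset.sum_sub_distrib, ← Finset.mul_sum]
  simp

theorem compatible_iff_compatibleOn (a b : ℕ → ℤˣ) :
    Compatible (fun k : Fin l => a k) (fun k : Fin l => b k) ↔ CompatibleOn a b 0 l := by
  have hp : ∀ i j : Fin l, Paired (fun k : Fin l => a k) i j ↔ IsPair a i j := fun i j => by
    simpa using paired_iff_isPair a 0 i j
  refine ⟨fun h i j _ hj hij => ?_, fun h i j hij => h i j (Nat.zero_le _) j.2 ((hp i j).1 hij)⟩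
  exact h ⟨i, hij.2.1.trans hj⟩ ⟨j, hj⟩ ((hp _ _).2 hij)

theorem pairingProd_eq {K : Type*} [Field K] (v : K) (a b : ℕ → ℤˣ) :
    pairingProd v a b 0 l
      = v ^ (Finset.univ.filter fun k : Fin l => b k = -1).card *
        ∏ j ∈ Finset.univ.filter fun k : Fin l => b k = -1,
          qInt v (sPrime (fun k : Fin l => a k) (fun k : Fin l => b k) j) := by
  rw [← Finset.prod_const, ← Finset.prod_mul_distrib, Finset.prod_filter, pairingProd,
    ← Finset.range_eq_Ico, ← Fin.prod_univ_eq_prod_range]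
  refine Finset.prod_congr rfl fun j _ => ?_
  rw [pairingFactor, sPrime, partialSum_eq_height b j.2.le]

end Counting
end TLTensor

open TLTensor in
theorem theoremt {K : Type*} [Field K] (v : K) (hv : v ≠ 0)
    (n : ℕ) (hn : qFactorial v n ≠ 0)
    (l : ℕ) (hl : l ≤ n) (m : ℕ)
    (α β : Fin l → ℤˣ) (hα : IsOneFactor α) (hβ : IsOneFactor β)
    (hαm : numPairings α = m) (hβm : numPairings β = m) :
    (Compatible α β →
      form K (natVec v α) (omegaVec v β)
        = v ^ m * ∏ j : Fin l with β j = -1, qInt v (sPrime α β j)) ∧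
    (¬ Compatible α β → form K (natVec v α) (omegaVec v β) = 0) := by
  -- The padding value `1` beyond `l` is arbitrary: only positions below `l` enter.
  have hext : ∀ γ : Fin l → ℤˣ, ∃ c : ℕ → ℤˣ, γ = fun k : Fin l => c k := fun γ =>
    ⟨fun k => if h : k < l then γ ⟨k, h⟩ else 1, by funext k; simp⟩
  obtain ⟨a, rfl⟩ := hext α
  obtain ⟨b, rfl⟩ := hext β
  have ha : ∀ k ≤ l, 0 ≤ height a k := fun k hk => partialSum_eq_height a hk ▸ hα k hk
  have hb : ∀ k ≤ l, 0 ≤ height b k := fun k hk => partialSum_eq_height b hk ▸ hβ k hk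
  rw [numPairings_eq_card a ha] at hαm
  rw [numPairings_eq_card b hb] at hβm
  have hab : height b l = height a l := by
    rw [height_eq_sub_card, height_eq_sub_card, hαm, hβm]
  have hN : natVec v (fun k : Fin l => a k) = natVecOn v a 0 l :=
    natVec_congr v rfl fun k _ _ => congrArg a (Nat.zero_add k).symm
  have hform : form K (natVec v fun k : Fin l => a k) (omegaVec v fun k : Fin l => b k)
      = form K 1 (contract K (natVecOn v a 0 l) (omegaPrefix v b l)) := by
    rw [← form_mul, one_mul, hN, omegaPrefix]
  obtain ⟨-, h1, h2⟩ := form_natVecOn_omegaPrefix (b := b) hv l ha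
  rw [hform, compatible_iff_compatibleOn]
  refine ⟨fun hc => ?_, fun hc => h2 fun h => hc h.1⟩
  rw [h1 hc hab, pairingProd_eq, hβm]
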